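/- Let $k\ge 2$ be a fixed integer. For positive integers $n,q$, consider the search version of $k$-Distinctness: given oracle access to a string $x\in\mathbb{Z}_q^n$ that contains $k$ equal elements, output a $k$-element set $\rho\subseteq\{1,\dots,n\}$ such that $x_i=x_j$ for all $i,j\in\rho$. A quantum query algorithm with $T$ queries acts on $\mathbb{C}^n\otimes\mathbb{C}^q\otimes\mathcal{W}$ with $\mathcal{W}$ an arbitrary finite-dimensional working register, applies $U_T O_x U_{T-1}\cdots U_1 O_x U_0$ to a fixed initial unit vector, where the $U_t$ are arbitrary unitaries independent of $x$ and $O_x\colon |i\rangle|c\rangle|w\rangle\mapsto e^{2\pi \mathrm{i}\,c x_i/q}|i\rangle|c\rangle|w\rangle$, and ends with an orthogonal measurement whose outcome is the output. **Theorem.** 1. For all constants $a,\varepsilon>0$ there are $c>0$ and $n_0$ (depending only on $k,a,\varepsilon$) such that for all $n\ge n_0$ and $q\ge a n^2$, every quantum query algorithm that, on every $x\in\mathbb{Z}_q^n$ containing $k$ equal elements, outputs a correct $\rho$ with probability at least $\varepsilon$ makes at least $$c\, n^{\frac34-\frac1{4(2^k-1)}}$$ queries. 2. The bound holds even if it is known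 that there is exactly one $k$-tuple of equal elements and the numbers of $\ell$-tuples for all $\ell<k$ are known in advance. Precisely, call an $\ell$-tuple of $x$ a set of exactly $\ell$ indices consisting of all positions of some symbol in $x$. For all constants $a,\varepsilon,\delta>0$ there are $c>0$ and $n_0$ (depending only on $k,a,\varepsilon,\delta$) such that, for all $n\ge n_0$ and $q\ge a n^2$ and all integers $m_1,\dots,m_{k-1}\ge\delta n$ and $m_k=1$ with $\sum_{\ell=1}^{k}\ell\, m_\ell=n$, every quantum query algorithm (which may depend on $m_1,\dots,m_{k-1}$) that outputs a correct $\rho$ with probability at least $\varepsilon$ on every $x\in\mathbb{Z}_q^n$ having exactly $m_\ell$ $\ell$-tuples for $1\le\ell\le k$ and none for $\ell>k$ makes at least $c\, n^{\frac34-\frac1{4(2^k-1)}}$ queries. Moreover, there is $\delta>0$ (depending only on $k$) such that numbers $m_1,\dots,m_k$ as above exist for all sufficiently large $n$. -/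

import Mathlib

open scoped BigOperators

noncomputable section

namespace KDistinctness

/-- The response set: all subsets of the index set `Fin n` of size `k`. -/
abbrev Response (n k : ℕ) : Type := {ρ : Finset (Fin n) // ρ.card = k}

/-- The state space of an algorithm: an index register of dimension `n`, a register of
dimension `q`, and a working register of dimension `d`. -/
abbrev StateSpace (n q d : ℕ) [NeZero q] : Type :=
  EuclideanSpace ℂ (Fin n × ZMod q × Fin d)

/-- The input oracle in the phase, tensored with the identity on the working register:
`|i⟩|c⟩|w⟩ ↦ ω ^ (c * x i) |i⟩|c⟩|w⟩` with `ω = exp (2 π i / q)`. -/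
def oracle {n q : ℕ} [NeZero q] (d : ℕ) (x : Fin n → ZMod q) :
    StateSpace n q d →ₗ[ℂ] StateSpace n q d where
  toFun ψ := WithLp.toLp 2 fun p => ZMod.stdAddChar (p.2.1 * x p.1) * ψ p
  map_add' ψ φ := by ext p; simp [mul_add]
  map_smul' a ψ := by ext p; simp [mul_left_comm]

/-- A quantum query algorithm `U_T O_x U_{T-1} ⋯ O_x U_1 O_x U_0` on inputs `x ∈ (ℤ/q)^n`, with
`T = queries`, followed by an orthogonal measurement with outcomes in `R`.
The unitaries `U t` with `t > T` are never used. -/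
structure QueryAlgorithm (n q : ℕ) [NeZero q] (R : Type) [Fintype R] where
  /-- the number of queries -/
  queries : ℕ
  /-- the dimension of the working register -/
  workDim : ℕ
  /-- the initial state -/
  init : StateSpace n q workDim
  norm_init : ‖init‖ = 1
  /-- the input-independent unitaries -/
  U : ℕ → (StateSpace n q workDim ≃ₗᵢ[ℂ] StateSpace n q workDim)
  /-- the projectors of the final measurement -/
  meas : R → (StateSpace n q workDim →L[ℂ] StateSpace n q workDim)
  isStarProjection_meas : ∀ ρ, IsStarProjection (meas ρ)
  sum_meas : ∑ ρ, meas ρ = 1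

namespace QueryAlgorithm

variable {n q : ℕ} [NeZero q] {R : Type} [Fintype R]

/-- The state on input `x` after `t` queries and the unitaries `U 0, …, U t`. -/
def state (A : QueryAlgorithm n q R) (x : Fin n → ZMod q) : ℕ → StateSpace n q A.workDim
  | 0 => A.U 0 A.init
  | t + 1 => A.U (t + 1) (oracle A.workDim x (A.state x t))

/-- The probability that the algorithm outputs `ρ` on input `x`. -/
def outputProb (A : QueryAlgorithm n q R) (x : Fin n → ZMod q) (ρ : R) : ℝ :=
  ‖A.meas ρ (A.state x A.queries)‖ ^ 2

/-- The probability that the output of the algorithm on input `x` lies in `S`. -/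
def successProb (A : QueryAlgorithm n q R) (x : Fin n → ZMod q) (S : Finset R) : ℝ :=
  ∑ ρ ∈ S, A.outputProb x ρ

end QueryAlgorithm

/-- The correct responses on input `x`: the `k`-subsets of indices on which `x` is constant. -/
def correct {n q : ℕ} (k : ℕ) (x : Fin n → ZMod q) : Finset (Response n k) :=
  Finset.univ.filter fun ρ => ∀ i ∈ ρ.1, ∀ j ∈ ρ.1, x i = x j

/-- The number of blocks of size exactly `ℓ` in the partition of the indices into classes of
equal elements of `x` (for `ℓ ≥ 1`): the number of symbols that occur exactly `ℓ` times. -/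
def blockCount {n q : ℕ} [NeZero q] (x : Fin n → ZMod q) (ℓ : ℕ) : ℕ :=
  (Finset.univ.filter fun v : ZMod q =>
    (Finset.univ.filter fun i : Fin n => x i = v).card = ℓ).card

/-- `A` solves the search version of `k`-Distinctness with success probability at least `ε`:
on every input with `k` equal elements it outputs `k` equal elements with probability `≥ ε`. -/
def Solves {n q : ℕ} [NeZero q] (k : ℕ) (ε : ℝ) (A : QueryAlgorithm n q (Response n k)) : Prop :=
  ∀ x : Fin n → ZMod q, (correct k x).Nonempty → ε ≤ A.successProb x (correct k x)

/-- The same, but only on the inputs that have exactly `m ℓ` blocks of size `ℓ` for all `ℓ ≥ 1`. -/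
def SolvesOnProfile {n q : ℕ} [NeZero q] (k : ℕ) (ε : ℝ) (m : ℕ → ℕ)
    (A : QueryAlgorithm n q (Response n k)) : Prop :=
  ∀ x : Fin n → ZMod q, (∀ ℓ, 1 ≤ ℓ → blockCount x ℓ = m ℓ) →
    ε ≤ A.successProb x (correct k x)

/-- Block sizes of partitions of `n` points with exactly one `k`-block, no larger block, and at
least `δ n` blocks of every size `1, …, k - 1`. -/
structure IsBalancedProfile (k n : ℕ) (δ : ℝ) (m : ℕ → ℕ) : Prop where
  unique_tuple : m k = 1
  no_larger : ∀ ℓ, k < ℓ → m ℓ = 0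
  many : ∀ ℓ, 1 ≤ ℓ → ℓ < k → δ * n ≤ m ℓ
  total : ∑ ℓ ∈ Finset.Icc 1 k, ℓ * m ℓ = n

/-- The exponent `3/4 - 1/(4 (2^k - 1))`. -/
def exponent (k : ℕ) : ℝ := 3 / 4 - 1 / (4 * ((2 : ℝ) ^ k - 1))

end KDistinctness

end

/-! Take a template `y` in which the `k` positions of `sp` carry unique symbols, and a symbol `z`
foreign to `y`. Writing `z` to all of `sp` gives a hard input with a single correct answer; writing
it to a proper subset does not reveal `sp`. For `K ⊆ sp`, knowledge of all of `K` is measured by the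
alternating sum, over `R ⊆ K`, of the states on the inputs with `z` written to `R`. Its squared
norm, summed over all permutations of symbols and indices, is the energy of `K`. It is `W = |Sym n
q|` for `K = ∅`, and 0 before the first query if `K` is nonempty.

A query preserves the norm of every slice outside `K`. On the slice of `j ∈ K` it can only add what
is already known about `K \ {j}` (`energy_succ_le`). There `j` is one of `N` interchangeable
singles, so the leak is at most `k / N` times the energy of a set with one element less (`leak_le`).
If `K` is a proper subset of `sp`, every input involved has `j` in one of at least `N` blocks of the
same size, so the weight on `K` is `O(W / N)` (`weight_le`). Hence each query adds `O(√(W E) / N)`,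
where `E` bounds the previous energy. With `τ` of order `T / N`, the energy at level `ℓ` is at most
`W τ ^ e_ℓ`, where `e_0 = 0` and `e_{ℓ+1} = 1 + e_ℓ / 2`, that is `e_ℓ = 2 - 2 / 2 ^ ℓ`
(`energy_le`).

For `K = sp` the block is unique and the weight is bounded only by the energy itself. So the square
root of the energy grows linearly, and the energy is `O(T² W τ ^ e_{k-1} / N) = O(W N τ ^ p)` with
`p = 2 + e_{k-1}` (`energy_self_le`). Success forces this energy to be of order `ε W` (`le_energy`),
so `T` is at least of order `N ^ (1 - 1/p)`, which is the claimed exponent for `N = δ n`. -/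

namespace KDistinctness

open Equiv (Perm)

/-! ### States split by the queried index -/

section Slices

variable {n q d : ℕ} [NeZero q]

/-- The part of a state in which the index register contains `i`. -/
def slice (i : Fin n) : StateSpace n q d →ₗ[ℂ] EuclideanSpace ℂ (ZMod q × Fin d) where
  toFun φ := WithLp.toLp 2 fun p => φ (i, p)
  map_add' ψ φ := by ext p; simp
  map_smul' a ψ := by ext p; simp

/-- The action of the oracle on a slice whose index has the value `v`. -/
noncomputable def phase (v : ZMod q) :
    EuclideanSpace ℂ (ZMod q × Fin d) →ₗ[ℂ] EuclideanSpace ℂ (ZMod q × Fin d) where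
  toFun φ := WithLp.toLp 2 fun p => ZMod.stdAddChar (p.1 * v) * φ p
  map_add' ψ φ := by ext p; simp [mul_add]
  map_smul' a ψ := by ext p; simp [mul_left_comm]

lemma norm_phase (v : ZMod q) (φ : EuclideanSpace ℂ (ZMod q × Fin d)) :
    ‖phase v φ‖ = ‖φ‖ := by
  simp [phase, EuclideanSpace.norm_eq, AddChar.norm_apply]

lemma slice_oracle (i : Fin n) (x : Fin n → ZMod q) (φ : StateSpace n q d) :
    slice i (oracle d x φ) = phase (x i) (slice i φ) := rfl

lemma norm_sq_eq_sum_slice (φ : StateSpace n q d) : ‖φ‖ ^ 2 = ∑ i, ‖slice i φ‖ ^ 2 := by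
  simp [slice, EuclideanSpace.norm_sq_eq, Fintype.sum_prod_type]

lemma norm_oracle (x : Fin n → ZMod q) (φ : StateSpace n q d) : ‖oracle d x φ‖ = ‖φ‖ := by
  rw [← sq_eq_sq₀ (norm_nonneg _) (norm_nonneg _), norm_sq_eq_sum_slice, norm_sq_eq_sum_slice]
  simp [slice_oracle, norm_phase]

lemma sum_norm_slice_sq_le (φ : StateSpace n q d) (s : Finset (Fin n)) (σ : Perm (Fin n)) :
    ∑ j ∈ s, ‖slice (σ j) φ‖ ^ 2 ≤ ‖φ‖ ^ 2 := by
  rw [norm_sq_eq_sum_slice, ← Equiv.sum_comp σ]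
  exact Finset.sum_le_univ_sum_of_nonneg fun _ => by positivity

end Slices

/-! ### Alternating sums and the effect of one query -/

/-- The alternating sum of `F` over the subsets of `K`. -/
def altSum {ι E : Type*} [AddCommGroup E] [Module ℂ E] (K : Finset ι) (F : Finset ι → E) : E :=
  ∑ R ∈ K.powerset, (-1 : ℂ) ^ R.card • F R

section AltSum

variable {ι E E' : Type*} [AddCommGroup E] [Module ℂ E] [AddCommGroup E'] [Module ℂ E']

lemma map_altSum (f : E →ₗ[ℂ] E') (K : Finset ι) (F : Finset ι → E) :
    f (altSum K F) = altSum K fun R => f (F R) := by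
  simp [altSum, map_sum]

lemma altSum_const (K : Finset ι) (hK : K.Nonempty) (v : E) : altSum K (fun _ => v) = 0 := by
  classical
  rw [altSum, ← Finset.sum_smul]
  have h := Finset.sum_powerset_neg_one_pow_card_of_nonempty hK
  have h' : (∑ R ∈ K.powerset, (-1 : ℂ) ^ R.card) = 0 := by exact_mod_cast h
  rw [h', zero_smul]

lemma altSum_congr {K : Finset ι} {F F' : Finset ι → E} (h : ∀ R ⊆ K, F R = F' R) :
    altSum K F = altSum K F' :=
  Finset.sum_congr rfl fun R hR => by rw [h R (Finset.mem_powerset.1 hR)]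

lemma altSum_eq_erase_add [DecidableEq ι] {K : Finset ι} {j : ι} (hj : j ∈ K)
    (F : Finset ι → E) :
    altSum K F = altSum (K.erase j) F - altSum (K.erase j) fun R => F (insert j R) := by
  have h : altSum (insert j (K.erase j)) F =
      altSum (K.erase j) F - altSum (K.erase j) fun R => F (insert j R) := by
    unfold altSum
    rw [Finset.sum_powerset_insert (Finset.notMem_erase j K), sub_eq_add_neg,
      ← Finset.sum_neg_distrib]
    congr 1
    refine Finset.sum_congr rfl fun R hR => ?_
    have : j ∉ R := fun h => Finset.notMem_erase j K (Finset.mem_powerset.1 hR h)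
    rw [Finset.card_insert_of_notMem this, pow_succ, mul_neg_one, neg_smul]
  rwa [Finset.insert_erase hj] at h

lemma norm_altSum_sq_le {E : Type*} [NormedAddCommGroup E] [NormedSpace ℂ E] (K : Finset ι)
    (F : Finset ι → E) :
    ‖altSum K F‖ ^ 2 ≤ 2 ^ K.card * ∑ R ∈ K.powerset, ‖F R‖ ^ 2 := by
  have h1 : ‖altSum K F‖ ≤ ∑ R ∈ K.powerset, ‖F R‖ :=
    (norm_sum_le _ _).trans_eq <| by simp [norm_smul]
  have h2 := sq_sum_le_card_mul_sum_sq (s := K.powerset) (f := fun R => ‖F R‖)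
  rw [Finset.card_powerset] at h2
  push_cast at h2
  exact (pow_le_pow_left₀ (norm_nonneg _) h1 2).trans h2

end AltSum

/-- On a slice outside `K` all inputs agree, so the oracle is one common isometry. On the slice of
`j ∈ K` only two phases occur, according to whether `j ∈ R`; replacing one by the other costs at
most twice the slice of the sum over `K.erase j`. -/
lemma norm_sq_altSum_oracle_le {n q d : ℕ} [NeZero q] (K : Finset (Fin n)) (σ : Perm (Fin n))
    (X : Finset (Fin n) → Fin n → ZMod q) (y : Fin n → ZMod q) (z : ZMod q)
    (hX : ∀ R i, X R (σ i) = if i ∈ R then z else y i)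
    (F : Finset (Fin n) → StateSpace n q d) :
    ‖altSum K fun R => oracle d (X R) (F R)‖ ^ 2 ≤ ‖altSum K F‖ ^ 2 +
      ∑ j ∈ K, (4 * (‖slice (σ j) (altSum K F)‖ * ‖slice (σ j) (altSum (K.erase j) F)‖) +
        4 * ‖slice (σ j) (altSum (K.erase j) F)‖ ^ 2) := by
  set a := fun j => ‖slice (σ j) (altSum K F)‖
  set b := fun j => ‖slice (σ j) (altSum (K.erase j) F)‖
  have key : ∀ j, ‖slice (σ j) (altSum K fun R => oracle d (X R) (F R))‖ ^ 2 ≤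
      a j ^ 2 + if j ∈ K then 4 * (a j * b j) + 4 * b j ^ 2 else 0 := by
    intro j
    rw [map_altSum]
    simp only [slice_oracle, hX]
    split_ifs with hj
    · set S := fun R => slice (σ j) (F R)
      set u := altSum (K.erase j) S
      set v := altSum (K.erase j) fun R => S (insert j R)
      have hu : ‖u‖ = b j := (congrArg norm (map_altSum _ _ _)).symm
      have huv : ‖u - v‖ = a j := by rw [← altSum_eq_erase_add hj, ← map_altSum]
      -- The sum is `phase (y j) u - phase z v`; adding and subtracting `phase z u` isolates `u -
      -- v`, the old slice.
      have h : altSum K (fun R => phase (if j ∈ R then z else y j) (S R)) =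
          phase z (u - v) + (phase (y j) u - phase z u) := by
        have hv : phase z v = altSum (K.erase j) fun R => phase z (S (insert j R)) :=
          map_altSum _ _ _
        rw [altSum_eq_erase_add hj, map_sub, hv, map_altSum (phase (y j))]
        simp only [Finset.mem_insert_self, if_true]
        rw [altSum_congr (F' := fun R => phase (y j) (S R))]
        · abel
        · intro R hR
          rw [if_neg fun h => Finset.notMem_erase j K (hR h)]
      have h' : ‖altSum K (fun R => phase (if j ∈ R then z else y j) (S R))‖ ≤ a j + 2 * b j := by
        rw [h]
        refine (norm_add_le _ _).trans ?_
        have := norm_sub_le (phase (y j) u) (phase z u)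
        simp only [norm_phase] at this ⊢
        linarith
      calc _ ≤ (a j + 2 * b j) ^ 2 := pow_le_pow_left₀ (norm_nonneg _) h' 2
        _ = _ := by ring
    · rw [altSum_congr (F' := fun R => phase (y j) (slice (σ j) (F R))), ← map_altSum,
        norm_phase, ← map_altSum, add_zero]
      intro R hR
      rw [if_neg fun h => hj (hR h)]
  rw [norm_sq_eq_sum_slice, norm_sq_eq_sum_slice (altSum K F), ← Equiv.sum_comp σ,
    ← Equiv.sum_comp σ (fun i => ‖slice i (altSum K F)‖ ^ 2)]
  refine (Finset.sum_le_sum fun j _ => key j).trans_eq ?_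
  rw [Finset.sum_add_distrib, Finset.sum_ite_mem, Finset.univ_inter]

/-! ### Symmetries of inputs -/

/-- The group acting on inputs by permutations of the alphabet and of the indices. -/
abbrev Sym (n q : ℕ) : Type := Perm (ZMod q) × Perm (Fin n)

/-- The action of `Sym n q` on inputs. -/
def act {n q : ℕ} (ω : Sym n q) (x : Fin n → ZMod q) : Fin n → ZMod q :=
  fun i => ω.1 (x (ω.2.symm i))

/-- The input `y` with the symbol `z` written to all positions in `R`. -/
def planted {n q : ℕ} (y : Fin n → ZMod q) (z : ZMod q) (R : Finset (Fin n)) : Fin n → ZMod q :=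
  fun i => if i ∈ R then z else y i

lemma act_mul {n q : ℕ} (ω h : Sym n q) (x : Fin n → ZMod q) :
    act (ω * h) x = act ω (act h x) := rfl

lemma act_apply {n q : ℕ} (ω : Sym n q) (x : Fin n → ZMod q) (i : Fin n) :
    act ω x (ω.2 i) = ω.1 (x i) := by simp [act]

/-- The positions of the symbol `v` in `x`. -/
def fiber {n q : ℕ} (x : Fin n → ZMod q) (v : ZMod q) : Finset (Fin n) :=
  Finset.univ.filter fun i => x i = v

lemma mem_fiber {n q : ℕ} {x : Fin n → ZMod q} {v : ZMod q} {i : Fin n} :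
    i ∈ fiber x v ↔ x i = v := by simp [fiber]

section Symmetry

variable {n q : ℕ}

/-- Two symbols that occur equally often can be exchanged by a symmetry of the input. -/
lemma exists_act_eq_self (x : Fin n → ZMod q) {a b : ZMod q}
    (hab : (fiber x a).card = (fiber x b).card) :
    ∃ h : Sym n q, act h x = x ∧ ∀ i, i ∈ fiber x a ↔ h.2 i ∈ fiber x b := by
  -- Exchanging `a` and `b` preserves all fiber sizes, so bijections between fibers glue to an index
  -- permutation that undoes the exchange.
  have hc : ∀ v, Nonempty ({i // x i = v} ≃ {i // Equiv.swap a b (x i) = v}) := by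
    intro v
    rw [← Fintype.card_eq, Fintype.card_subtype, Fintype.card_subtype]
    have h1 : ∀ w, (Finset.univ.filter fun i => Equiv.swap a b (x i) = w) =
        fiber x (Equiv.swap a b w) := by
      intro w; ext i
      simp [mem_fiber, Equiv.swap_apply_eq_iff]
    rw [h1]
    change (fiber x v).card = _
    rw [Equiv.swap_apply_def]
    split_ifs with h h'
    · rw [h, hab]
    · rw [h', hab]
    · rfl
  have e := fun v => (hc v).some
  let π : Perm (Fin n) := Equiv.ofFiberEquiv e
  have hπ : ∀ i, Equiv.swap a b (x (π i)) = x i := fun i => Equiv.ofFiberEquiv_map e i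
  have hπ' : ∀ i, x (π i) = Equiv.swap a b (x i) := fun i => by
    rw [← hπ i, Equiv.swap_apply_self]
  refine ⟨(Equiv.swap a b, π), ?_, fun i => ?_⟩
  · funext i
    have := hπ (π.symm i)
    rw [Equiv.apply_symm_apply] at this
    simp [act, ← this]
  · rw [mem_fiber, mem_fiber, hπ', Equiv.swap_apply_eq_iff, Equiv.swap_apply_right]

variable [NeZero q]

lemma sum_sym_mul_right (h : Sym n q) (f : Sym n q → ℝ) : ∑ ω, f (ω * h) = ∑ ω, f ω :=
  Equiv.sum_comp (Equiv.mulRight h) f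

/-- If many symbols occur as often as the symbol at position `j`, then on average over the
symmetries the weight of a unit vector on the position `j` is small. -/
lemma card_mul_sum_slice_le {d : ℕ} (F : (Fin n → ZMod q) → StateSpace n q d)
    (hF : ∀ x, ‖F x‖ = 1) (x : Fin n → ZMod q) (j : Fin n) (V : Finset (ZMod q))
    (hV : ∀ v ∈ V, (fiber x (x j)).card = (fiber x v).card) :
    V.card * ∑ ω : Sym n q, ‖slice (ω.2 j) (F (act ω x))‖ ^ 2 ≤ Fintype.card (Sym n q) := by
  have h1 : ∀ v ∈ V, ∑ ω : Sym n q, ‖slice (ω.2 j) (F (act ω x))‖ ^ 2 ≤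
      ∑ ω : Sym n q, ∑ i ∈ fiber x v, ‖slice (ω.2 i) (F (act ω x))‖ ^ 2 := by
    intro v hv
    obtain ⟨h, hx, hi⟩ := exists_act_eq_self x (hV v hv).symm
    rw [← sum_sym_mul_right h fun ω => ∑ i ∈ fiber x v, ‖slice (ω.2 i) (F (act ω x))‖ ^ 2]
    refine Finset.sum_le_sum fun ω _ => ?_
    have hj : h.2.symm j ∈ fiber x v := by
      rw [hi, Equiv.apply_symm_apply, mem_fiber]
    have := Finset.single_le_sum (f := fun i =>
      ‖slice ((ω * h).2 i) (F (act (ω * h) x))‖ ^ 2) (fun _ _ => by positivity) hj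
    simpa [act_mul, hx] using this
  calc _ = ∑ v ∈ V, ∑ ω : Sym n q, ‖slice (ω.2 j) (F (act ω x))‖ ^ 2 := by simp
    _ ≤ ∑ v ∈ V, ∑ ω : Sym n q, ∑ i ∈ fiber x v, ‖slice (ω.2 i) (F (act ω x))‖ ^ 2 :=
      Finset.sum_le_sum h1
    _ = ∑ ω : Sym n q, ∑ v ∈ V, ∑ i ∈ fiber x v, ‖slice (ω.2 i) (F (act ω x))‖ ^ 2 :=
      Finset.sum_comm
    _ ≤ ∑ ω : Sym n q, 1 := by
      refine Finset.sum_le_sum fun ω _ => ?_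
      have hd : Set.PairwiseDisjoint (V : Set (ZMod q)) (fiber x) := by
        intro v _ w _ hvw
        refine Finset.disjoint_left.2 fun i hi hi' => hvw ?_
        rw [← mem_fiber.1 hi, ← mem_fiber.1 hi']
      rw [← Finset.sum_biUnion hd]
      refine (sum_norm_slice_sq_le _ _ _).trans_eq (by rw [hF, one_pow])
    _ = _ := by simp

end Symmetry

/-! ### Templates and interchangeable positions -/

/-- The image of a response under a permutation of the indices. -/
def Response.image {n k : ℕ} (σ : Perm (Fin n)) (ρ : Response n k) : Response n k :=
  ⟨ρ.1.map σ.toEmbedding, by rw [Finset.card_map, ρ.2]⟩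

/-- The symbols of `y` on `sp` are unique, and `y` does not contain `z`. Moreover, for `1 ≤ r < k`
there are at least `N` symbols not on `sp` that occur exactly `r` times. -/
structure IsTemplate {n q k : ℕ} (N : ℝ) (sp : Response n k) (y : Fin n → ZMod q)
    (z : ZMod q) : Prop where
  notMem : ∀ i, y i ≠ z
  fiber_sp : ∀ j ∈ sp.1, fiber y (y j) = {j}
  many : ∀ r, 1 ≤ r → r < k → ∃ V : Finset (ZMod q), N ≤ V.card ∧
    ∀ v ∈ V, v ≠ z ∧ (∀ j ∈ sp.1, v ≠ y j) ∧ (fiber y v).card = r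

/-- The alternating sum of `F` over the inputs with the symbol `z` written to a subset of `K`. -/
def diff {n q d : ℕ} [NeZero q] (F : (Fin n → ZMod q) → StateSpace n q d) (y : Fin n → ZMod q)
    (z : ZMod q) (K : Finset (Fin n)) (ω : Sym n q) : StateSpace n q d :=
  altSum K fun R => F (act ω (planted y z R))

/-- Since `‖M ρ v‖ ^ 2 = ⟪v, M ρ v⟫` for a projection, summing to the identity suffices. -/
lemma sum_norm_sq_of_isStarProjection {E ι : Type*} [NormedAddCommGroup E]
    [InnerProductSpace ℂ E] [CompleteSpace E] [Fintype ι] (M : ι → E →L[ℂ] E)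
    (hM : ∀ ρ, IsStarProjection (M ρ)) (hsum : ∑ ρ, M ρ = 1) (v : E) :
    ∑ ρ, ‖M ρ v‖ ^ 2 = ‖v‖ ^ 2 := by
  have h : ∀ ρ, ((‖M ρ v‖ ^ 2 : ℝ) : ℂ) = inner ℂ v (M ρ v) := by
    intro ρ
    have h1 : M ρ (M ρ v) = M ρ v := congrArg (fun f => f v) (hM ρ).isIdempotentElem.eq
    have h2 : ContinuousLinearMap.adjoint (M ρ) = M ρ := (hM ρ).isSelfAdjoint.star_eq
    conv_rhs => rw [← h1, ← h2, ContinuousLinearMap.adjoint_inner_right, h2]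
    rw [inner_self_eq_norm_sq_to_K]
    simp
  have h' : ((∑ ρ, ‖M ρ v‖ ^ 2 : ℝ) : ℂ) = ((‖v‖ ^ 2 : ℝ) : ℂ) := by
    rw [Complex.ofReal_sum, Finset.sum_congr rfl fun ρ _ => h ρ, ← inner_sum,
      ← sum_apply, hsum, one_apply_eq_self,
      inner_self_eq_norm_sq_to_K]
    simp
  exact_mod_cast h'

namespace IsTemplate

variable {n q k : ℕ} {N : ℝ} {sp : Response n k} {y : Fin n → ZMod q} {z : ZMod q}

lemma exists_singles (h : IsTemplate N sp y z) (hk : 1 < k) : ∃ S : Finset (Fin n),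
    N ≤ S.card ∧ ∀ s ∈ S, s ∉ sp.1 ∧ fiber y (y s) = {s} := by
  obtain ⟨V, hN, hV⟩ := h.many 1 le_rfl hk
  refine ⟨V.biUnion (fiber y), ?_, fun s hs => ?_⟩
  · rw [Finset.card_biUnion]
    · rw [Finset.sum_congr rfl fun v hv => (hV v hv).2.2]
      simpa using hN
    · intro v _ w _ hvw
      refine Finset.disjoint_left.2 fun i hi hi' => hvw ?_
      rw [← mem_fiber.1 hi, ← mem_fiber.1 hi']
  · obtain ⟨v, hv, hs⟩ := Finset.mem_biUnion.1 hs
    obtain ⟨i, hi⟩ := Finset.card_eq_one.1 (hV v hv).2.2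
    have hsi : s = i := by simpa [hi] using hs
    rw [mem_fiber.1 hs, hi, hsi]
    refine ⟨fun hsp => (hV v hv).2.1 i hsp ?_, rfl⟩
    rw [← hsi, mem_fiber.1 hs]

lemma fiber_planted (h : IsTemplate N sp y z) (R : Finset (Fin n)) :
    fiber (planted y z R) z = R := by
  ext i
  simp [mem_fiber, planted, h.notMem]

lemma fiber_planted_of_ne {R : Finset (Fin n)} {v : ZMod q} (hv : v ≠ z)
    (hvR : ∀ j ∈ R, v ≠ y j) : fiber (planted y z R) v = fiber y v := by
  ext i
  simp only [mem_fiber, planted]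
  split_ifs with hi
  · exact ⟨fun e => (hv e.symm).elim, fun e => (hvR i hi e.symm).elim⟩
  · rfl

/-- Both `j` and `s` carry symbols that occur nowhere else, so swapping the positions and the
symbols together changes nothing. -/
lemma act_swap (h : IsTemplate N sp y z) {R : Finset (Fin n)} (hR : R ⊆ sp.1) {j s : Fin n}
    (hj : j ∈ sp.1) (hjR : j ∉ R) (hs : s ∉ sp.1) (hs' : fiber y (y s) = {s}) :
    act (Equiv.swap (y j) (y s), Equiv.swap j s) (planted y z R) = planted y z R := by
  have hsR : s ∉ R := fun hsR => hs (hR hsR)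
  funext i
  change Equiv.swap (y j) (y s) (planted y z R (Equiv.swap j s i)) = planted y z R i
  by_cases hij : i = j
  · subst hij; simp [planted, hsR, hjR]
  by_cases his : i = s
  · subst his; simp [planted, hsR, hjR]
  rw [Equiv.swap_apply_of_ne_of_ne hij his, planted]
  split_ifs with hi
  · rw [Equiv.swap_apply_of_ne_of_ne (h.notMem _).symm (h.notMem _).symm]
  · rw [Equiv.swap_apply_of_ne_of_ne]
    · intro hy
      exact hij (by simpa [h.fiber_sp j hj] using mem_fiber.2 hy)
    · intro hy
      exact his (by simpa [hs'] using mem_fiber.2 hy)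

variable [NeZero q]

/-- The difference on `K` does not depend on which single is the further element `j`. -/
lemma mul_sum_slice_diff_le (h : IsTemplate N sp y z) (hk : 1 < k) {d : ℕ}
    (F : (Fin n → ZMod q) → StateSpace n q d) {K : Finset (Fin n)} (hK : K ⊆ sp.1) {j : Fin n}
    (hj : j ∈ sp.1) (hjK : j ∉ K) :
    N * ∑ ω : Sym n q, ‖slice (ω.2 j) (diff F y z K ω)‖ ^ 2 ≤
      ∑ ω : Sym n q, ‖diff F y z K ω‖ ^ 2 := by
  obtain ⟨S, hN, hS⟩ := h.exists_singles hk
  have h1 : ∀ s ∈ S, ∑ ω : Sym n q, ‖slice (ω.2 j) (diff F y z K ω)‖ ^ 2 =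
      ∑ ω : Sym n q, ‖slice (ω.2 s) (diff F y z K ω)‖ ^ 2 := by
    intro s hs
    rw [← sum_sym_mul_right (Equiv.swap (y j) (y s), Equiv.swap j s)
      fun ω => ‖slice (ω.2 s) (diff F y z K ω)‖ ^ 2]
    refine Finset.sum_congr rfl fun ω _ => ?_
    have h2 : diff F y z K (ω * (Equiv.swap (y j) (y s), Equiv.swap j s)) = diff F y z K ω :=
      altSum_congr fun R hR => by
        rw [act_mul, h.act_swap (hR.trans hK) hj (fun h => hjK (hR h)) (hS s hs).1 (hS s hs).2]
    rw [h2]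
    simp
  calc _ ≤ (S.card : ℝ) * ∑ ω : Sym n q, ‖slice (ω.2 j) (diff F y z K ω)‖ ^ 2 := by gcongr
    _ = ∑ s ∈ S, ∑ ω : Sym n q, ‖slice (ω.2 j) (diff F y z K ω)‖ ^ 2 := by simp
    _ = ∑ ω : Sym n q, ∑ s ∈ S, ‖slice (ω.2 s) (diff F y z K ω)‖ ^ 2 := by
      rw [Finset.sum_congr rfl h1, Finset.sum_comm]
    _ ≤ _ := Finset.sum_le_sum fun ω _ => sum_norm_slice_sq_le _ _ _

/-- A measurement does not find `sp` if the symbol `z` is only written to a part of it. -/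
lemma mul_sum_meas_le (h : IsTemplate N sp y z) (hk : 1 < k) {d : ℕ}
    (F : (Fin n → ZMod q) → StateSpace n q d) (hF : ∀ x, ‖F x‖ = 1)
    (M : Response n k → StateSpace n q d →L[ℂ] StateSpace n q d)
    (hM : ∀ ρ, IsStarProjection (M ρ)) (hsum : ∑ ρ, M ρ = 1)
    {R : Finset (Fin n)} (hR : R ⊂ sp.1) :
    N * ∑ ω : Sym n q, ‖M (sp.image ω.2) (F (act ω (planted y z R)))‖ ^ 2 ≤
      Fintype.card (Sym n q) := by
  obtain ⟨S, hN, hS⟩ := h.exists_singles hk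
  obtain ⟨j, hj, hjR⟩ := Finset.exists_of_ssubset hR
  have h1 : ∀ s ∈ S, ∑ ω : Sym n q, ‖M (sp.image ω.2) (F (act ω (planted y z R)))‖ ^ 2 =
      ∑ ω : Sym n q,
        ‖M (sp.image (ω.2 * Equiv.swap j s)) (F (act ω (planted y z R)))‖ ^ 2 := by
    intro s hs
    rw [← sum_sym_mul_right (Equiv.swap (y j) (y s), Equiv.swap j s)]
    refine Finset.sum_congr rfl fun ω _ => ?_
    rw [act_mul, h.act_swap hR.1 hj hjR (hS s hs).1 (hS s hs).2]
    rfl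
  calc _ ≤ (S.card : ℝ) *
        ∑ ω : Sym n q, ‖M (sp.image ω.2) (F (act ω (planted y z R)))‖ ^ 2 := by gcongr
    _ = ∑ s ∈ S, ∑ ω : Sym n q, ‖M (sp.image ω.2) (F (act ω (planted y z R)))‖ ^ 2 := by simp
    _ = ∑ ω : Sym n q, ∑ s ∈ S,
        ‖M (sp.image (ω.2 * Equiv.swap j s)) (F (act ω (planted y z R)))‖ ^ 2 := by
      rw [Finset.sum_congr rfl h1, Finset.sum_comm]
    _ ≤ ∑ ω : Sym n q, 1 := by
      refine Finset.sum_le_sum fun ω _ => ?_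
      -- Among these responses only the one for `s` contains `ω.2 s`. Distinct outcomes have total
      -- probability at most 1.
      have hinj : Set.InjOn (fun s => sp.image (ω.2 * Equiv.swap j s)) S := by
        intro s hs s' hs' hss
        by_contra hne
        have hm : ω.2 s ∈ (sp.image (ω.2 * Equiv.swap j s)).1 := by
          simp only [Response.image, Finset.mem_map_equiv]
          simpa [Equiv.Perm.mul_def] using hj
        have hsj : s ≠ j := fun e => (hS s hs).1 (e ▸ hj)
        simp only at hss
        rw [hss] at hm
        simp only [Response.image, Finset.mem_map_equiv] at hm
        rw [Equiv.Perm.mul_def, Equiv.symm_trans_apply, Equiv.symm_apply_apply,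
          Equiv.symm_swap, Equiv.swap_apply_of_ne_of_ne hsj hne] at hm
        exact (hS s hs).1 hm
      rw [← Finset.sum_image (f := fun ρ => ‖M ρ (F (act ω (planted y z R)))‖ ^ 2) hinj]
      refine (Finset.sum_le_univ_sum_of_nonneg fun _ => by positivity).trans_eq ?_
      rw [sum_norm_sq_of_isStarProjection M hM hsum, hF, one_pow]
    _ = _ := by simp

/-- The weight of the positions of `sp` in the states on inputs with less than `k` equal elements
in `sp`. -/
lemma mul_sum_slice_le (h : IsTemplate N sp y z) (hk : 1 < k) {d : ℕ}
    (F : (Fin n → ZMod q) → StateSpace n q d) (hF : ∀ x, ‖F x‖ = 1) {R : Finset (Fin n)}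
    (hR : R ⊂ sp.1) {j : Fin n} (hj : j ∈ sp.1) :
    N * ∑ ω : Sym n q, ‖slice (ω.2 j) (F (act ω (planted y z R)))‖ ^ 2 ≤
      Fintype.card (Sym n q) := by
  -- The block of `j` has size `R.card` if `j ∈ R` and 1 otherwise; both are less than `k`.
  obtain ⟨r, hr, hrk, hjr⟩ : ∃ r, 1 ≤ r ∧ r < k ∧
      (fiber (planted y z R) (planted y z R j)).card = r := by
    refine ⟨_, ?_, ?_, rfl⟩
    · exact Finset.card_pos.2 ⟨j, mem_fiber.2 rfl⟩
    · by_cases hjR : j ∈ R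
      · have : planted y z R j = z := if_pos hjR
        rw [this, h.fiber_planted]
        exact (Finset.card_lt_card hR).trans_eq sp.2
      · have : planted y z R j = y j := if_neg hjR
        rw [this, fiber_planted_of_ne (h.notMem j), h.fiber_sp j hj, Finset.card_singleton]
        · exact hk
        · intro i hi e
          have : i ∈ fiber y (y j) := mem_fiber.2 e.symm
          rw [h.fiber_sp j hj, Finset.mem_singleton] at this
          exact hjR (this ▸ hi)
  obtain ⟨V, hN, hV⟩ := h.many r hr hrk
  refine le_trans ?_ (card_mul_sum_slice_le F hF (planted y z R) j V fun v hv => ?_)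
  · gcongr
  · rw [hjr, fiber_planted_of_ne (hV v hv).1 fun i hi => (hV v hv).2.1 i (hR.1 hi), (hV v hv).2.2]

end IsTemplate

/-! ### Energy and its growth in one query -/

namespace QueryAlgorithm

variable {n q k : ℕ} [NeZero q] {R : Type} [Fintype R]

lemma norm_state (A : QueryAlgorithm n q R) (x : Fin n → ZMod q) (t : ℕ) :
    ‖A.state x t‖ = 1 := by
  induction t with
  | zero => simp [state, A.norm_init]
  | succ t ih => simp [state, norm_oracle, ih]

/-- The difference on `K` of the states after `t` queries. -/
noncomputable def stateDiff (A : QueryAlgorithm n q R) (y : Fin n → ZMod q) (z : ZMod q) (K : Finset (Fin n))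
    (t : ℕ) (ω : Sym n q) : StateSpace n q A.workDim :=
  diff (fun x => A.state x t) y z K ω

/-- The total squared norm of the differences on `K`: how much the algorithm knows about `K`. -/
noncomputable def energy (A : QueryAlgorithm n q R) (y : Fin n → ZMod q) (z : ZMod q)
    (K : Finset (Fin n)) (t : ℕ) : ℝ :=
  ∑ ω : Sym n q, ‖A.stateDiff y z K t ω‖ ^ 2

variable (A : QueryAlgorithm n q R) (y : Fin n → ZMod q) (z : ZMod q)

lemma energy_nonneg (K : Finset (Fin n)) (t : ℕ) : 0 ≤ A.energy y z K t :=
  Finset.sum_nonneg fun _ _ => by positivity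

lemma energy_empty (t : ℕ) : A.energy y z ∅ t = Fintype.card (Sym n q) := by
  simp [energy, stateDiff, diff, altSum, norm_state]

lemma energy_zero {K : Finset (Fin n)} (hK : K.Nonempty) : A.energy y z K 0 = 0 := by
  simp [energy, stateDiff, diff, state, altSum_const K hK]

/-- The weight of the elements of `K` in the difference on `K`. -/
noncomputable def weight (K : Finset (Fin n)) (t : ℕ) : ℝ :=
  ∑ ω : Sym n q, ∑ j ∈ K, ‖slice (ω.2 j) (A.stateDiff y z K t ω)‖ ^ 2

/-- The weight of the elements `j ∈ K` in the differences on `K \ {j}`. -/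
noncomputable def leak (K : Finset (Fin n)) (t : ℕ) : ℝ :=
  ∑ ω : Sym n q, ∑ j ∈ K, ‖slice (ω.2 j) (A.stateDiff y z (K.erase j) t ω)‖ ^ 2

lemma leak_nonneg (K : Finset (Fin n)) (t : ℕ) : 0 ≤ A.leak y z K t :=
  Finset.sum_nonneg fun _ _ => Finset.sum_nonneg fun _ _ => by positivity

lemma weight_le_energy (K : Finset (Fin n)) (t : ℕ) : A.weight y z K t ≤ A.energy y z K t :=
  Finset.sum_le_sum fun _ _ => sum_norm_slice_sq_le _ _ _

/-- The one-query estimate summed over all symmetries, with Cauchy–Schwarz over the pairs `(ω, j)`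
for the cross terms. The unitary is the same on all inputs and so drops out. -/
lemma energy_succ_le (K : Finset (Fin n)) (t : ℕ) :
    A.energy y z K (t + 1) ≤ A.energy y z K t +
      4 * (√(A.weight y z K t) * √(A.leak y z K t)) + 4 * A.leak y z K t := by
  have h1 : ∀ ω : Sym n q, ‖A.stateDiff y z K (t + 1) ω‖ ^ 2 ≤ ‖A.stateDiff y z K t ω‖ ^ 2 +
      ∑ j ∈ K, (4 * (‖slice (ω.2 j) (A.stateDiff y z K t ω)‖ *
          ‖slice (ω.2 j) (A.stateDiff y z (K.erase j) t ω)‖) +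
        4 * ‖slice (ω.2 j) (A.stateDiff y z (K.erase j) t ω)‖ ^ 2) := by
    intro ω
    have h2 : A.stateDiff y z K (t + 1) ω = A.U (t + 1) (altSum K fun R =>
        oracle A.workDim (act ω (planted y z R)) (A.state (act ω (planted y z R)) t)) :=
      (map_altSum (A.U (t + 1)).toLinearEquiv.toLinearMap _ _).symm
    rw [h2, LinearIsometryEquiv.norm_map]
    refine norm_sq_altSum_oracle_le K ω.2 (fun R => act ω (planted y z R)) (fun i => ω.1 (y i))
      (ω.1 z) (fun R i => ?_) (fun R => A.state (act ω (planted y z R)) t)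
    rw [act_apply, planted, apply_ite ω.1]
  refine (Finset.sum_le_sum fun ω _ => h1 ω).trans ?_
  rw [Finset.sum_add_distrib]
  have h3 : ∑ ω : Sym n q, ∑ j ∈ K, ‖slice (ω.2 j) (A.stateDiff y z K t ω)‖ *
      ‖slice (ω.2 j) (A.stateDiff y z (K.erase j) t ω)‖ ≤
        √(A.weight y z K t) * √(A.leak y z K t) := by
    unfold weight leak
    simp only [← Finset.sum_product']
    exact Real.sum_mul_le_sqrt_mul_sqrt _ _ _
  simp only [Finset.sum_add_distrib, ← Finset.mul_sum]
  unfold energy leak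
  unfold leak at h3
  linarith

end QueryAlgorithm

/-! ### Energy bounds by the size of the set -/

namespace IsTemplate

variable {n q k : ℕ} [NeZero q] {R : Type} [Fintype R] {N : ℝ} {sp : Response n k}
  {y : Fin n → ZMod q} {z : ZMod q}

open QueryAlgorithm

lemma leak_le (h : IsTemplate N sp y z) (hk : 1 < k) (hN : 0 < N) (A : QueryAlgorithm n q R)
    {K : Finset (Fin n)} (hK : K ⊆ sp.1) (t : ℕ) {B : ℝ}
    (hB : ∀ j ∈ K, A.energy y z (K.erase j) t ≤ B) : A.leak y z K t ≤ K.card * (B / N) := by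
  unfold leak
  rw [Finset.sum_comm, ← nsmul_eq_mul]
  refine Finset.sum_le_card_nsmul _ _ _ fun j hj => ?_
  rw [le_div_iff₀' hN]
  exact (h.mul_sum_slice_diff_le hk _ ((Finset.erase_subset _ _).trans hK) (hK hj)
    (Finset.notMem_erase _ _)).trans (hB j hj)

/-- Properness of `K` keeps every planted block below size `k`, where blocks are plentiful. The
factor `4 ^ K.card` is the number of subsets times the Cauchy–Schwarz constant. -/
lemma weight_le (h : IsTemplate N sp y z) (hk : 1 < k) (hN : 0 < N) (A : QueryAlgorithm n q R)
    {K : Finset (Fin n)} (hK : K ⊂ sp.1) (t : ℕ) :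
    A.weight y z K t ≤ K.card * (4 ^ K.card * (Fintype.card (Sym n q) / N)) := by
  unfold weight
  rw [Finset.sum_comm, ← nsmul_eq_mul]
  refine Finset.sum_le_card_nsmul _ _ _ fun j hj => ?_
  have h1 : ∀ ω : Sym n q, ‖slice (ω.2 j) (A.stateDiff y z K t ω)‖ ^ 2 ≤
      2 ^ K.card * ∑ R ∈ K.powerset,
        ‖slice (ω.2 j) (A.state (act ω (planted y z R)) t)‖ ^ 2 := by
    intro ω
    rw [stateDiff, diff, map_altSum]
    exact norm_altSum_sq_le _ _
  refine (Finset.sum_le_sum fun ω _ => h1 ω).trans ?_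
  rw [← Finset.mul_sum, Finset.sum_comm]
  have h2 : ∀ R ∈ K.powerset, ∑ ω : Sym n q,
      ‖slice (ω.2 j) (A.state (act ω (planted y z R)) t)‖ ^ 2 ≤ Fintype.card (Sym n q) / N := by
    intro R hR
    rw [le_div_iff₀' hN]
    exact h.mul_sum_slice_le hk (fun x => A.state x t) (fun x => A.norm_state x t)
      ((Finset.mem_powerset.1 hR).trans_ssubset hK) (hK.1 hj)
  have h3 := Finset.sum_le_card_nsmul _ _ _ h2
  rw [Finset.card_powerset, nsmul_eq_mul] at h3
  calc _ ≤ (2 : ℝ) ^ K.card * (((2 ^ K.card : ℕ) : ℝ) * (Fintype.card (Sym n q) / N)) := by gcongr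
    _ = _ := by
      push_cast
      rw [← mul_assoc, ← mul_pow]
      norm_num

/-- The energy of a set of `ℓ < k` elements. -/
lemma energy_le (h : IsTemplate N sp y z) (hk : 1 < k) (hN : 0 < N) (A : QueryAlgorithm n q R)
    {T : ℕ} {τ : ℝ} (hτ0 : 0 < τ) (hτ1 : τ ≤ 1) (hτ : 8 * k * 2 ^ k * T / N ≤ τ) (ℓ : ℕ)
    (hℓ : ℓ < k) (K : Finset (Fin n)) (hK : K ⊆ sp.1) (hKℓ : K.card = ℓ) (t : ℕ) (ht : t ≤ T) :
    A.energy y z K t ≤ Fintype.card (Sym n q) * τ ^ (2 - 2 * (1 / 2 : ℝ) ^ ℓ) := by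
  induction ℓ generalizing K t with
  | zero => simp [Finset.card_eq_zero.1 hKℓ, energy_empty]
  | succ ℓ ih =>
    set W : ℝ := ((Fintype.card (Sym n q) : ℕ) : ℝ)
    -- The inductive bound is `W * b ^ 2`, and the new one is `W * (τ * b)`.
    set b : ℝ := τ ^ (1 - (1 / 2 : ℝ) ^ ℓ) with hb
    have hW : 0 ≤ W := by positivity
    have hb0 : 0 ≤ b := by positivity
    have hb1 : b ≤ 1 := Real.rpow_le_one hτ0.le hτ1 (by
      rw [sub_nonneg]; exact pow_le_one₀ (by norm_num) (by norm_num))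
    have hbb : τ ^ (2 - 2 * (1 / 2 : ℝ) ^ ℓ) = b ^ 2 := by
      rw [← Real.rpow_natCast b 2, hb, ← Real.rpow_mul hτ0.le]
      congr 1; push_cast; ring
    have hbτ : τ ^ (2 - 2 * (1 / 2 : ℝ) ^ (ℓ + 1)) = τ * b := by
      rw [hb, ← Real.rpow_one_add' hτ0.le]
      · congr 1; ring
      · have : (1 / 2 : ℝ) ^ ℓ ≤ 1 := pow_le_one₀ (by norm_num) (by norm_num)
        linarith
    have hKs : K ⊂ sp.1 := by
      refine Finset.ssubset_iff_subset_ne.2 ⟨hK, fun e => ?_⟩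
      have := sp.2
      rw [← e, hKℓ] at this
      omega
    have hKk : (K.card : ℝ) ≤ k := by exact_mod_cast (hKℓ ▸ hℓ).le
    have hstep : ∀ s ≤ T, A.energy y z K (s + 1) ≤
        A.energy y z K s + W * (8 * k * 2 ^ k / N) * b := by
      intro s hs
      have h1 : A.leak y z K s ≤ k * (W * b ^ 2 / N) := by
        refine (h.leak_le hk hN A hK s fun j hj => ?_).trans
          (mul_le_mul_of_nonneg_right hKk (by positivity))
        rw [← hbb]
        refine ih (by omega) _ ((Finset.erase_subset _ _).trans hK) ?_ s hs
        rw [Finset.card_erase_of_mem hj, hKℓ, Nat.add_sub_cancel]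
      have h2 : A.weight y z K s ≤ k * (4 ^ k * (W / N)) := by
        refine (h.weight_le hk hN A hKs s).trans ?_
        gcongr
        · norm_num
        · exact (hKℓ ▸ hℓ).le
      have h3 : √(A.weight y z K s) * √(A.leak y z K s) ≤ k * 2 ^ k * (W / N) * b := by
        rw [← Real.sqrt_mul' _ (A.leak_nonneg y z K s)]
        refine Real.sqrt_le_iff.2 ⟨by positivity, ?_⟩
        calc _ ≤ k * (4 ^ k * (W / N)) * (k * (W * b ^ 2 / N)) := by
              gcongr; exact A.leak_nonneg y z K s
          _ = _ := by
            rw [show (4 : ℝ) = 2 ^ 2 by norm_num, ← pow_mul]; ring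
      have h4 : A.leak y z K s ≤ k * 2 ^ k * (W / N) * b := by
        refine h1.trans ?_
        -- Deliberately crude: it gives the leak the same form as the cross term, so that `4 + 4 =
        -- 8` is the only constant.
        have h5 : b ^ 2 ≤ 2 ^ k * b := by
          rw [sq]
          exact mul_le_mul_of_nonneg_right (hb1.trans (one_le_pow₀ (by norm_num))) hb0
        calc (k : ℝ) * (W * b ^ 2 / N) ≤ k * (W * (2 ^ k * b) / N) := by gcongr
          _ = _ := by ring
      refine (A.energy_succ_le y z K s).trans ?_
      calc _ ≤ A.energy y z K s + 4 * (k * 2 ^ k * (W / N) * b) +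
            4 * (k * 2 ^ k * (W / N) * b) := by gcongr
        _ = _ := by ring
    have hlin : ∀ s ≤ T, A.energy y z K s ≤ s * (W * (8 * k * 2 ^ k / N) * b) := by
      intro s hs
      induction s with
      | zero =>
        rw [energy_zero _ _ _ (Finset.card_pos.1 (by omega))]; simp
      | succ s ihs =>
        have h1 := hstep s (by omega)
        have h2 := ihs (by omega)
        push_cast
        linarith
    rw [hbτ]
    calc _ ≤ t * (W * (8 * k * 2 ^ k / N) * b) := hlin t ht
      _ ≤ T * (W * (8 * k * 2 ^ k / N) * b) := by gcongr
      _ = W * ((8 * k * 2 ^ k * T / N) * b) := by ring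
      _ ≤ _ := by gcongr

/-- The energy of a set of `k` elements. -/
lemma energy_self_le (h : IsTemplate N sp y z) (hk : 1 < k) (hN : 0 < N)
    (A : QueryAlgorithm n q R) {T : ℕ} {τ : ℝ} (hτ0 : 0 < τ) (hτ1 : τ ≤ 1)
    (hτ : 8 * k * 2 ^ k * T / N ≤ τ) :
    A.energy y z sp.1 T ≤ T ^ 2 * (4 * (k * (Fintype.card (Sym n q) *
      τ ^ (2 - 2 * (1 / 2 : ℝ) ^ (k - 1)) / N))) := by
  set B : ℝ := k * (Fintype.card (Sym n q) * τ ^ (2 - 2 * (1 / 2 : ℝ) ^ (k - 1)) / N) with hB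
  have hB0 : 0 ≤ B := by positivity
  have hlin : ∀ s ≤ T, √(A.energy y z sp.1 s) ≤ s * (2 * √B) := by
    intro s hs
    induction s with
    | zero => rw [energy_zero _ _ _ (Finset.card_pos.1 (by rw [sp.2]; omega))]; simp
    | succ s ihs =>
      have h1 : A.leak y z sp.1 s ≤ B := by
        refine (h.leak_le hk hN A subset_rfl s fun j hj => ?_).trans_eq (by rw [sp.2])
        refine h.energy_le hk hN A hτ0 hτ1 hτ _ (by omega) _ (Finset.erase_subset _ _) ?_ s
          (by omega)
        rw [Finset.card_erase_of_mem hj, sp.2]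
      have h2 : √(A.energy y z sp.1 (s + 1)) ≤ √(A.energy y z sp.1 s) + 2 * √B := by
        refine Real.sqrt_le_iff.2 ⟨by positivity, (A.energy_succ_le y z sp.1 s).trans ?_⟩
        calc _ ≤ A.energy y z sp.1 s + 4 * (√(A.energy y z sp.1 s) * √B) + 4 * B := by
              gcongr
              exact A.weight_le_energy y z sp.1 s
          _ = √(A.energy y z sp.1 s) ^ 2 + 4 * (√(A.energy y z sp.1 s) * √B) + 4 * √B ^ 2 := by
              rw [Real.sq_sqrt (A.energy_nonneg _ _ _ _), Real.sq_sqrt hB0]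
          _ = _ := by ring
      have h3 := ihs (by omega)
      push_cast
      linarith
  have h1 := hlin T le_rfl
  calc A.energy y z sp.1 T = √(A.energy y z sp.1 T) ^ 2 :=
        (Real.sq_sqrt (A.energy_nonneg _ _ _ _)).symm
    _ ≤ (T * (2 * √B)) ^ 2 := pow_le_pow_left₀ (Real.sqrt_nonneg _) h1 2
    _ = T ^ 2 * (4 * √B ^ 2) := by ring
    _ = _ := by rw [Real.sq_sqrt hB0]

/-- An algorithm that finds `sp` has a large energy. -/
lemma le_energy (h : IsTemplate N sp y z) (hk : 1 < k) (hN : 0 < N)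
    (A : QueryAlgorithm n q (Response n k)) {ε : ℝ}
    (hε : ∀ ω : Sym n q, ε ≤ A.outputProb (act ω (planted y z sp.1)) (sp.image ω.2)) :
    Fintype.card (Sym n q) * ε ≤ 2 ^ k *
      (A.energy y z sp.1 A.queries + 2 ^ k * (Fintype.card (Sym n q) / N)) := by
  classical
  set T := A.queries
  set M := fun ω : Sym n q => A.meas (sp.image ω.2)
  have hM : ∀ ω v, ‖M ω v‖ ≤ ‖v‖ := by
    intro ω v
    have h1 := sum_norm_sq_of_isStarProjection A.meas A.isStarProjection_meas A.sum_meas v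
    have h2 := Finset.single_le_sum (f := fun ρ => ‖A.meas ρ v‖ ^ 2)
      (fun _ _ => by positivity) (Finset.mem_univ (sp.image ω.2))
    rw [h1] at h2
    exact (sq_le_sq₀ (norm_nonneg _) (norm_nonneg _)).1 h2
  set P := sp.1.powerset.erase sp.1
  have key : ∀ ω : Sym n q, ε ≤ 2 ^ k * (‖A.stateDiff y z sp.1 T ω‖ ^ 2 +
      ∑ R ∈ P, ‖M ω (A.state (act ω (planted y z R)) T)‖ ^ 2) := by
    intro ω
    set f := fun R => M ω (A.state (act ω (planted y z R)) T)
    have h1 : M ω (A.stateDiff y z sp.1 T ω) =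
        (-1 : ℂ) ^ sp.1.card • f sp.1 + ∑ R ∈ P, (-1 : ℂ) ^ R.card • f R := by
      have h2 : M ω (A.stateDiff y z sp.1 T ω) = altSum sp.1 f :=
        map_altSum (M ω).toLinearMap _ _
      rw [h2, altSum, Finset.add_sum_erase _ (fun R => (-1 : ℂ) ^ R.card • f R)
        (Finset.mem_powerset_self _)]
    have h2 : ‖f sp.1‖ ≤ ‖A.stateDiff y z sp.1 T ω‖ + ∑ R ∈ P, ‖f R‖ := by
      have h3 : (-1 : ℂ) ^ sp.1.card • f sp.1 =
          M ω (A.stateDiff y z sp.1 T ω) - ∑ R ∈ P, (-1 : ℂ) ^ R.card • f R := by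
        rw [h1]; abel
      have h4 := congrArg norm h3
      rw [norm_smul, norm_pow, norm_neg, norm_one, one_pow, one_mul] at h4
      rw [h4]
      refine (norm_sub_le _ _).trans (add_le_add (hM _ _) ((norm_sum_le _ _).trans_eq ?_))
      simp [norm_smul]
    -- Putting the norm of the difference in the place of `R = sp.1` leaves exactly `2 ^ k` terms
    -- for Cauchy–Schwarz.
    set g := Function.update (fun R => ‖f R‖) sp.1 ‖A.stateDiff y z sp.1 T ω‖ with hg
    have hsp : g sp.1 = ‖A.stateDiff y z sp.1 T ω‖ := Function.update_self _ _ _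
    have hP : ∀ R ∈ P, g R = ‖f R‖ := fun R hR =>
      Function.update_of_ne (Finset.ne_of_mem_erase hR) _ _
    have hP2 : ∑ R ∈ P, g R ^ 2 = ∑ R ∈ P, ‖f R‖ ^ 2 :=
      Finset.sum_congr rfl fun R hR => by rw [hP R hR]
    have h5 := sq_sum_le_card_mul_sum_sq (s := sp.1.powerset) (f := g)
    rw [← Finset.add_sum_erase _ g (Finset.mem_powerset_self _),
      ← Finset.add_sum_erase _ (fun R => g R ^ 2) (Finset.mem_powerset_self _), hsp,
      Finset.sum_congr rfl hP, hP2,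
      Finset.card_powerset, sp.2] at h5
    push_cast at h5
    exact (hε ω).trans ((pow_le_pow_left₀ (norm_nonneg _) h2 2).trans h5)
  have h1 := Finset.sum_le_sum fun ω (_ : ω ∈ Finset.univ) => key ω
  simp only [Finset.sum_const, Finset.card_univ, nsmul_eq_mul, ← Finset.mul_sum] at h1
  refine h1.trans ?_
  rw [Finset.sum_add_distrib, Finset.sum_comm (t := P)]
  gcongr ?_ * (?_ + ?_)
  · rfl
  refine (Finset.sum_le_card_nsmul P _ ((Fintype.card (Sym n q) : ℝ) / N) fun R hR => ?_).trans ?_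
  · rw [le_div_iff₀' hN]
    have hR' := Finset.mem_erase.1 hR
    exact h.mul_sum_meas_le hk (fun x => A.state x T) (fun x => A.norm_state x T) A.meas
      A.isStarProjection_meas A.sum_meas
      (Finset.ssubset_iff_subset_ne.2 ⟨Finset.mem_powerset.1 hR'.2, hR'.1⟩)
  · rw [nsmul_eq_mul]
    gcongr
    have : P.card ≤ 2 ^ k := by
      rw [← sp.2, ← Finset.card_powerset]; exact Finset.card_erase_le
    exact_mod_cast this

end IsTemplate

/-! ### Inputs with a given profile and their templates -/

lemma fiber_act {n q : ℕ} (ω : Sym n q) (x : Fin n → ZMod q) (v : ZMod q) :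
    fiber (act ω x) (ω.1 v) = (fiber x v).map ω.2.toEmbedding := by
  ext i
  simp [mem_fiber, act, Finset.mem_map_equiv]

lemma blockCount_act {n q : ℕ} [NeZero q] (ω : Sym n q) (x : Fin n → ZMod q) (ℓ : ℕ) :
    blockCount (act ω x) ℓ = blockCount x ℓ := by
  refine (Finset.card_bij (fun v _ => ω.1 v) (fun v hv => ?_)
    (fun v _ w _ h => ω.1.injective h) fun w hw => ?_).symm
  · have h := (Finset.mem_filter.1 hv).2
    change (fiber x v).card = ℓ at h
    refine Finset.mem_filter.2 ⟨Finset.mem_univ _, ?_⟩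
    change (fiber (act ω x) (ω.1 v)).card = ℓ
    rw [fiber_act, Finset.card_map, h]
  · have h := (Finset.mem_filter.1 hw).2
    change (fiber (act ω x) w).card = ℓ at h
    refine ⟨ω.1.symm w, Finset.mem_filter.2 ⟨Finset.mem_univ _, ?_⟩, Equiv.apply_symm_apply _ _⟩
    change (fiber x _).card = ℓ
    rw [← h, ← Equiv.apply_symm_apply ω.1 w, fiber_act, Finset.card_map, Equiv.symm_apply_apply]

lemma correct_act {n q k : ℕ} {x : Fin n → ZMod q} {sp : Response n k} (h : correct k x = {sp})
    (ω : Sym n q) : correct k (act ω x) = {sp.image ω.2} := by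
  have hmem : ∀ ρ : Response n k, ρ ∈ correct k x ↔ ∀ i ∈ ρ.1, ∀ j ∈ ρ.1, x i = x j := by
    simp [correct]
  ext ρ
  have h1 : ρ ∈ correct k (act ω x) ↔ ρ.image ω.2.symm ∈ correct k x := by
    rw [hmem]
    simp only [correct, Response.image, act, Finset.mem_filter, Finset.mem_univ, true_and,
      Finset.mem_map_equiv, Equiv.symm_symm, EmbeddingLike.apply_eq_iff_eq]
    exact ⟨fun H i hi j hj => by simpa using H _ hi _ hj,
      fun H i hi j hj => H _ (by simpa using hi) _ (by simpa using hj)⟩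
  rw [h1, h, Finset.mem_singleton, Finset.mem_singleton]
  constructor
  · rintro rfl
    ext i; simp [Response.image, Finset.mem_map_equiv]
  · rintro rfl
    ext i; simp [Response.image, Finset.mem_map_equiv]

/-- A `k`-set on which `x` is constant lies in a fiber of size at most `k`, hence is that fiber, and
only one fiber has size `k`. -/
lemma correct_eq_singleton {n q k : ℕ} [NeZero q] (hk : 1 < k) {x : Fin n → ZMod q} {z : ZMod q}
    (sp : Response n k) (hsp : fiber x z = sp.1) (hone : blockCount x k = 1)
    (hlarge : ∀ ℓ, k < ℓ → blockCount x ℓ = 0) : correct k x = {sp} := by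
  have hmem : ∀ v, v ∈ Finset.univ.filter (fun v : ZMod q => (fiber x v).card = k) ↔ v = z := by
    obtain ⟨w, hw⟩ := Finset.card_eq_one.1 hone
    change Finset.univ.filter (fun v : ZMod q => (fiber x v).card = k) = {w} at hw
    have hz : z ∈ Finset.univ.filter (fun v : ZMod q => (fiber x v).card = k) :=
      Finset.mem_filter.2 ⟨Finset.mem_univ _, by rw [hsp, sp.2]⟩
    rw [hw, Finset.mem_singleton] at hz
    intro v
    rw [hw, Finset.mem_singleton, hz]
  ext ρ
  rw [correct, Finset.mem_filter, Finset.mem_singleton]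
  constructor
  · rintro ⟨-, h⟩
    obtain ⟨i, hi⟩ : ρ.1.Nonempty := Finset.card_pos.1 (by rw [ρ.2]; omega)
    have hsub : ρ.1 ⊆ fiber x (x i) := fun j hj => mem_fiber.2 (h j hj i hi)
    have hle : (fiber x (x i)).card ≤ k := by
      by_contra! hlt
      have h0 := hlarge _ hlt
      rw [blockCount, Finset.card_eq_zero] at h0
      have : x i ∈ Finset.univ.filter
          (fun v : ZMod q => (fiber x v).card = (fiber x (x i)).card) := by simp
      exact (Finset.notMem_empty (x i)) (h0 ▸ this)
    have heq : ρ.1 = fiber x (x i) := Finset.eq_of_subset_of_card_le hsub (by rw [ρ.2]; exact hle)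
    have hz : x i = z := (hmem _).1 (Finset.mem_filter.2 ⟨Finset.mem_univ _, by rw [← heq, ρ.2]⟩)
    rw [hz, hsp] at heq
    exact Subtype.ext heq
  · rintro rfl
    refine ⟨Finset.mem_univ _, fun i hi j hj => ?_⟩
    rw [← hsp] at hi hj
    rw [mem_fiber.1 hi, mem_fiber.1 hj]

/-- There are inputs with prescribed numbers of blocks. -/
lemma exists_blockCount_eq {n q k : ℕ} [NeZero q] (hnq : n ≤ q) (m : ℕ → ℕ)
    (hlarge : ∀ ℓ, k < ℓ → m ℓ = 0) (htotal : ∑ ℓ ∈ Finset.Icc 1 k, ℓ * m ℓ = n) :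
    ∃ x : Fin n → ZMod q, ∀ ℓ, 1 ≤ ℓ → blockCount x ℓ = m ℓ := by
  -- Sizes are shifted by one: the index `ℓ : Fin k` stands for blocks of size `ℓ + 1`.
  let Blk := Σ ℓ : Fin k, Fin (m (ℓ + 1))
  let Idx := Σ b : Blk, Fin (b.1 + 1)
  have hIdx : Fintype.card Idx = n := by
    rw [← htotal]
    simp only [Idx, Blk, Fintype.card_sigma, Fintype.card_fin, Fintype.sum_sigma,
      Finset.sum_const, Finset.card_univ, smul_eq_mul]
    rw [Fin.sum_univ_eq_sum_range (fun ℓ => m (ℓ + 1) * (ℓ + 1)) k,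
      Finset.range_eq_Ico, Finset.sum_Ico_add' (fun ℓ => m ℓ * ℓ) 0 k 1]
    refine Finset.sum_congr ?_ fun ℓ _ => mul_comm _ _
    ext; simp
  have hBlk : Fintype.card Blk ≤ Fintype.card (ZMod q) := by
    rw [ZMod.card]
    refine le_trans ?_ hnq
    rw [← hIdx]
    exact Fintype.card_le_of_injective (fun b => (⟨b, 0⟩ : Idx)) fun b b' h => congrArg (·.1) h
  obtain ⟨ι⟩ := Function.Embedding.nonempty_of_card_le hBlk
  let e : Fin n ≃ Idx := (Fintype.equivFinOfCardEq hIdx).symm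
  let x : Fin n → ZMod q := fun i => ι (e i).1
  have hfib : ∀ b : Blk, (fiber x (ι b)).card = b.1 + 1 := by
    intro b
    have h1 : fiber x (ι b) = (Finset.univ.map
        ⟨fun c : Fin (b.1 + 1) => e.symm ⟨b, c⟩, fun c c' h =>
          eq_of_heq (Sigma.mk.inj (e.symm.injective h)).2⟩) := by
      ext i
      simp only [mem_fiber, x, Finset.mem_map, Finset.mem_univ, true_and,
        ι.injective.eq_iff]
      constructor
      · intro h
        rcases hei : e i with ⟨b', c⟩
        rw [hei] at h
        subst h
        exact ⟨c, (Equiv.symm_apply_eq e).2 hei.symm⟩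
      · rintro ⟨c, rfl⟩
        exact congrArg (·.1) (e.apply_symm_apply ⟨b, c⟩)
    rw [h1, Finset.card_map, Finset.card_univ, Fintype.card_fin]
  have hfib0 : ∀ v, (∀ b, ι b ≠ v) → (fiber x v).card = 0 := by
    intro v hv
    rw [Finset.card_eq_zero, Finset.eq_empty_iff_forall_notMem]
    exact fun i hi => hv _ (mem_fiber.1 hi)
  refine ⟨x, fun ℓ hℓ => ?_⟩
  by_cases hℓk : k < ℓ
  · rw [hlarge ℓ hℓk, blockCount, Finset.card_eq_zero, Finset.filter_eq_empty_iff]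
    intro v _ hv
    change (fiber x v).card = ℓ at hv
    by_cases hb : ∃ b, ι b = v
    · obtain ⟨b, rfl⟩ := hb
      rw [hfib] at hv
      have := b.1.2
      omega
    · push Not at hb
      rw [hfib0 v hb] at hv
      omega
  · have hlt : ℓ - 1 < k := by omega
    have hℓ1 : m (ℓ - 1 + 1) = m ℓ := by rw [Nat.sub_add_cancel hℓ]
    have h1 : Finset.univ.filter (fun v : ZMod q => (fiber x v).card = ℓ) =
        Finset.univ.map ⟨fun c : Fin (m (ℓ - 1 + 1)) => ι ⟨⟨ℓ - 1, hlt⟩, c⟩, fun c c' h =>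
          eq_of_heq (Sigma.mk.inj (ι.injective h)).2⟩ := by
      ext v
      simp only [Finset.mem_filter, Finset.mem_univ, true_and, Finset.mem_map]
      constructor
      · intro hv
        by_cases hb : ∃ b, ι b = v
        · obtain ⟨⟨⟨l, hl⟩, c⟩, rfl⟩ := hb
          rw [hfib] at hv
          have : l = ℓ - 1 := by simp only at hv; omega
          subst this
          exact ⟨c, rfl⟩
        · push Not at hb
          rw [hfib0 v hb] at hv
          omega
      · rintro ⟨c, rfl⟩
        exact (hfib _).trans (Nat.sub_add_cancel hℓ)
    change (Finset.univ.filter (fun v : ZMod q => (fiber x v).card = ℓ)).card = m ℓ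
    rw [h1, Finset.card_map, Finset.card_univ, Fintype.card_fin, hℓ1]

/-- An input with the block counts `m` arises by writing a symbol to the positions of a
template. -/
lemma exists_isTemplate {n q k : ℕ} [NeZero q] (hk : 1 < k) (hnq : 2 * n ≤ q) {N : ℝ}
    {x : Fin n → ZMod q} (hone : blockCount x k = 1) (hlarge : ∀ ℓ, k < ℓ → blockCount x ℓ = 0)
    (hmany : ∀ r, 1 ≤ r → r < k → N ≤ blockCount x r) :
    ∃ (sp : Response n k) (y : Fin n → ZMod q) (z : ZMod q), IsTemplate N sp y z ∧
      planted y z sp.1 = x ∧ correct k x = {sp} := by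
  classical
  obtain ⟨z, hz⟩ := Finset.card_pos.1 (hone ▸ Nat.one_pos : 0 < blockCount x k)
  have hzk : (fiber x z).card = k := (Finset.mem_filter.1 hz).2
  let sp : Response n k := ⟨fiber x z, hzk⟩
  -- As `2 * n ≤ q`, there are `n` symbols absent from `x`; the template writes distinct ones over
  -- the `k`-block.
  have hcard : Fintype.card (Fin n) ≤ Fintype.card {v : ZMod q // v ∉ Finset.univ.image x} := by
    rw [Fintype.card_subtype_compl, Fintype.card_fin, ZMod.card, Fintype.card_coe]
    have : (Finset.univ.image x).card ≤ n := Finset.card_image_le.trans_eq (by simp)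
    omega
  obtain ⟨ι⟩ := Function.Embedding.nonempty_of_card_le hcard
  have hι : ∀ i j, (ι i : ZMod q) ≠ x j := fun i j h =>
    (ι i).2 (h ▸ Finset.mem_image_of_mem x (Finset.mem_univ j))
  have hιι : ∀ i j, (ι i : ZMod q) = ι j → i = j := fun i j h => ι.injective (Subtype.ext h)
  let y : Fin n → ZMod q := fun i => if i ∈ fiber x z then ι i else x i
  have hy : ∀ i ∈ fiber x z, y i = ι i := fun i hi => if_pos hi
  have hy' : ∀ i ∉ fiber x z, y i = x i := fun i hi => if_neg hi
  refine ⟨sp, y, z, ⟨fun i => ?_, fun j hj => ?_, fun r hr hrk => ?_⟩, ?_,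
    correct_eq_singleton hk sp rfl hone hlarge⟩
  · by_cases hi : i ∈ fiber x z
    · obtain ⟨j, hj⟩ := Finset.card_pos.1 (hzk ▸ (by omega) : 0 < (fiber x z).card)
      rw [hy i hi, ← mem_fiber.1 hj]
      exact hι i j
    · rw [hy' i hi]
      exact fun h => hi (mem_fiber.2 h)
  · ext i
    rw [mem_fiber, hy j hj, Finset.mem_singleton]
    by_cases hi : i ∈ fiber x z
    · rw [hy i hi]
      exact ⟨hιι i j, fun h => by rw [h]⟩
    · rw [hy' i hi]
      exact ⟨fun h => (hι j i h.symm).elim, fun h => (hi (h ▸ hj)).elim⟩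
  · refine ⟨Finset.univ.filter fun v : ZMod q => (fiber x v).card = r, hmany r hr hrk,
      fun v hv => ?_⟩
    have hv' := (Finset.mem_filter.1 hv).2
    have hvz : v ≠ z := by rintro rfl; omega
    obtain ⟨i, hi⟩ := Finset.card_pos.1 (by omega : 0 < (fiber x v).card)
    have hvy : ∀ j ∈ sp.1, v ≠ y j := fun j hj h => by
      rw [hy j hj, ← mem_fiber.1 hi] at h
      exact hι j i h.symm
    refine ⟨hvz, hvy, ?_⟩
    rw [← hv']
    congr 1
    ext j
    rw [mem_fiber, mem_fiber]
    by_cases hj : j ∈ fiber x z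
    · exact ⟨fun h => (hvy j hj h.symm).elim, fun h => (hvz (h ▸ mem_fiber.1 hj)).elim⟩
    · rw [hy' j hj]
  · funext i
    by_cases hi : i ∈ fiber x z
    · exact (if_pos hi).trans (mem_fiber.1 hi).symm
    · exact (if_neg hi).trans (hy' i hi)

/-! ### Balancing the bounds and the final constants -/

lemma inv_add_exponent {k : ℕ} (hk : 1 < k) :
    1 - (4 - 2 * (1 / 2 : ℝ) ^ (k - 1))⁻¹ = exponent k := by
  obtain ⟨l, rfl⟩ : ∃ l, k = l + 1 := ⟨k - 1, by omega⟩
  have h2 : (1 : ℝ) < 2 ^ (l + 1) := one_lt_pow₀ (by norm_num) (by omega)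
  have h3 : (2 : ℝ) ^ (l + 1) - 1 ≠ 0 := by linarith
  have h4 : (4 - 2 * (1 / 2 : ℝ) ^ l) = 4 * (2 ^ (l + 1) - 1) / 2 ^ (l + 1) := by
    rw [one_div, inv_pow]; field_simp; ring
  rw [Nat.add_sub_cancel, h4, exponent, inv_div]
  field_simp
  ring

/-- The number of queries of an algorithm that finds `sp`. -/
lemma IsTemplate.lt_queries {n q k : ℕ} [NeZero q] {N ε : ℝ} {sp : Response n k}
    {y : Fin n → ZMod q} {z : ZMod q} (h : IsTemplate N sp y z) (hk : 1 < k) (hN : 0 < N)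
    (hε : 0 < ε) (hεN : 2 * 4 ^ k ≤ ε * N) (hN' : ε ≤ 2 * N)
    (A : QueryAlgorithm n q (Response n k))
    (hA : ∀ ω : Sym n q, ε ≤ A.outputProb (act ω (planted y z sp.1)) (sp.image ω.2)) :
    (ε / (2 * N)) ^ (4 - 2 * (1 / 2 : ℝ) ^ (k - 1))⁻¹ * N < 8 * k * 2 ^ k * A.queries := by
  set p : ℝ := 4 - 2 * (1 / 2 : ℝ) ^ (k - 1)
  have hp : 0 < p := by
    have : (1 / 2 : ℝ) ^ (k - 1) ≤ 1 := pow_le_one₀ (by norm_num) (by norm_num)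
    simp only [p]; linarith
  set τ : ℝ := (ε / (2 * N)) ^ p⁻¹ with hτdef
  have hτ0 : 0 < τ := by positivity
  have hτ1 : τ ≤ 1 :=
    Real.rpow_le_one (by positivity) ((div_le_one (by positivity)).2 hN') (by positivity)
  have hτp : τ ^ p = ε / (2 * N) := Real.rpow_inv_rpow (by positivity) hp.ne'
  -- This `τ` makes `τ ^ p` equal to `ε / (2 * N)`. If `T` were small enough for the energy bounds
  -- to apply with it, the energy term in `h3` would be at most `ε / 4` and the term for proper
  -- subsets at most `ε / 2`.
  by_contra! hT
  set T : ℝ := (A.queries : ℝ)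
  have hT0 : 0 ≤ T := Nat.cast_nonneg _
  have h1 := h.energy_self_le hk hN A (T := A.queries) hτ0 hτ1 (by rw [div_le_iff₀ hN]; exact hT)
  have h2 := h.le_energy hk hN A hA
  set W : ℝ := ((Fintype.card (Sym n q) : ℕ) : ℝ)
  have hW : 0 < W := by
    simp only [W]; exact_mod_cast Fintype.card_pos
  set b : ℝ := τ ^ (2 - 2 * (1 / 2 : ℝ) ^ (k - 1)) with hb
  have hb0 : 0 < b := by positivity
  have hbτ : τ ^ 2 * b = ε / (2 * N) := by
    rw [← hτp, hb, ← Real.rpow_natCast τ 2, ← Real.rpow_add hτ0]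
    congr 1; push_cast; simp only [p]; ring
  have hk0 : (1 : ℝ) < k := by exact_mod_cast hk
  have hpow : (1 : ℝ) ≤ 2 ^ k := one_le_pow₀ (by norm_num)
  have h3 : ε ≤ 2 ^ k * (T ^ 2 * (4 * (k * b / N))) + 4 ^ k / N := by
    refine le_of_mul_le_mul_left ?_ hW
    refine (h2.trans (mul_le_mul_of_nonneg_left (add_le_add_left h1 _) (by positivity))).trans_eq ?_
    rw [show (4 : ℝ) ^ k = 2 ^ k * 2 ^ k by rw [← mul_pow]; norm_num]
    ring
  have h4 : 4 ^ k / N ≤ ε / 2 := by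
    rw [div_le_iff₀ hN]; linarith
  have h5 : (8 * k * 2 ^ k * T) ^ 2 ≤ (τ * N) ^ 2 := pow_le_pow_left₀ (by positivity) hT 2
  have h6 : 16 * k * 2 ^ k * (2 ^ k * (T ^ 2 * (4 * (k * b / N)))) ≤ ε / 2 := by
    calc _ = (8 * k * 2 ^ k * T) ^ 2 * (b / N) := by ring
      _ ≤ (τ * N) ^ 2 * (b / N) := by gcongr
      _ = (τ ^ 2 * b) * N := by field_simp
      _ = ε / 2 := by rw [hbτ]; field_simp
  have h7 : (2 : ℝ) ≤ 16 * k * 2 ^ k := by nlinarith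
  have h8 : 0 ≤ 2 ^ k * (T ^ 2 * (4 * (k * b / N))) := by positivity
  nlinarith

/-- With `n / (2 * k ^ 2)` blocks of each size from 2 to `k - 1`, at most half of the points are
used; the singles absorb the remainder. -/
lemma exists_isBalancedProfile {k : ℕ} (hk : 1 < k) {n : ℕ} (hn : 4 * k ^ 2 ≤ n) :
    ∃ m : ℕ → ℕ, IsBalancedProfile k n (1 / (4 * k ^ 2)) m := by
  set s := n / (2 * k ^ 2) with hs
  set r := ∑ ℓ ∈ Finset.Ico 2 k, ℓ * s with hr
  have hkk : 2 * k ≤ k ^ 2 := by nlinarith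
  have hsn : s * (2 * k ^ 2) ≤ n := Nat.div_mul_le_self _ _
  have hr' : 2 * r ≤ n := by
    have h1 : r ≤ k * (k * s) := by
      refine (Finset.sum_le_card_nsmul _ _ (k * s) fun ℓ hℓ => ?_).trans ?_
      · exact Nat.mul_le_mul_right _ (Finset.mem_Ico.1 hℓ).2.le
      · rw [Nat.card_Ico, smul_eq_mul]
        exact Nat.mul_le_mul_right _ (by omega)
    nlinarith
  have hs1 : n ≤ 4 * k ^ 2 * s := by
    have h1 : n < s * (2 * k ^ 2) + 2 * k ^ 2 := Nat.lt_div_mul_add (by positivity)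
    nlinarith
  have hk0 : (0 : ℝ) < 4 * (k : ℝ) ^ 2 := by positivity
  refine ⟨fun ℓ => if ℓ = k then 1 else if ℓ = 1 then n - k - r else if ℓ < k then s else 0,
    by simp, fun ℓ hℓ => ?_, fun ℓ h1 h2 => ?_, ?_⟩
  · simp [show ℓ ≠ k by omega, show ℓ ≠ 1 by omega, show ¬ ℓ < k by omega]
  · rw [one_div, inv_mul_le_iff₀ hk0]
    by_cases hℓ : ℓ = 1
    · have h3 : n ≤ 4 * (n - k - r) := by omega
      have h4 : 4 * (n - k - r) ≤ 4 * k ^ 2 * (n - k - r) :=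
        Nat.mul_le_mul_right _ (by nlinarith)
      simp only [hℓ, show (1 : ℕ) ≠ k by omega, if_true, if_false]
      exact_mod_cast h3.trans h4
    · simp only [h2.ne, hℓ, h2, if_true, if_false]
      exact_mod_cast hs1
  · have hIcc : Finset.Icc 1 k = Finset.Ico 1 (k + 1) := by ext; simp
    rw [hIcc, Finset.sum_Ico_succ_top (by omega), Finset.sum_eq_sum_Ico_succ_bot hk]
    have h1 : ∑ ℓ ∈ Finset.Ico (1 + 1) k, ℓ * (if ℓ = k then 1 else
        if ℓ = 1 then n - k - r else if ℓ < k then s else 0) = r := by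
      refine Finset.sum_congr rfl fun ℓ hℓ => ?_
      have := Finset.mem_Ico.1 hℓ
      simp [show ℓ ≠ k by omega, show ℓ ≠ 1 by omega, this.2]
    rw [h1]
    simp only [show (1 : ℕ) ≠ k by omega, if_true, if_false]
    omega

/-- The lower bound for inputs with a balanced profile. -/
lemma exists_le_queries_of_solvesOnProfile {k : ℕ} (hk : 1 < k) {a ε δ : ℝ} (ha : 0 < a)
    (hε : 0 < ε) (hδ : 0 < δ) : ∃ c : ℝ, 0 < c ∧ ∃ n₀ : ℕ, ∀ n : ℕ, n₀ ≤ n →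
      ∀ (q : ℕ) [NeZero q], a * (n : ℝ) ^ 2 ≤ q → ∀ m : ℕ → ℕ, IsBalancedProfile k n δ m →
      ∀ A : QueryAlgorithm n q (Response n k), SolvesOnProfile k ε m A →
        c * (n : ℝ) ^ exponent k ≤ A.queries := by
  set p : ℝ := 4 - 2 * (1 / 2 : ℝ) ^ (k - 1) with hp
  have hk0 : (0 : ℝ) < k := by exact_mod_cast (by omega : 0 < k)
  -- The constant is read off from `IsTemplate.lt_queries` at `N = δ * n`. The ceilings give its two
  -- conditions on `N` and `2 * n ≤ q`; the final 1 gives `0 < n`.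
  refine ⟨(ε / (2 * δ)) ^ p⁻¹ * δ / (8 * k * 2 ^ k), by positivity,
    ⌈2 * 4 ^ k / (ε * δ)⌉₊ + ⌈ε / (2 * δ)⌉₊ + ⌈2 / a⌉₊ + 1, ?_⟩
  intro n hn q _ hq m hm A hA
  have hle : ∀ u : ℝ, ⌈u⌉₊ ≤ n → u ≤ n := fun u hu =>
    (Nat.le_ceil u).trans (by exact_mod_cast hu)
  have hn0 : (0 : ℝ) < n := by exact_mod_cast (by omega : 0 < n)
  have h1 : 2 * 4 ^ k ≤ ε * (δ * n) := by
    have := hle (2 * 4 ^ k / (ε * δ)) (by omega)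
    rw [div_le_iff₀ (by positivity)] at this
    linarith
  have h2 : ε ≤ 2 * (δ * n) := by
    have := hle (ε / (2 * δ)) (by omega)
    rw [div_le_iff₀ (by positivity)] at this
    linarith
  have h3 : 2 * n ≤ q := by
    have := hle (2 / a) (by omega)
    rw [div_le_iff₀ ha] at this
    have h4 : (2 : ℝ) * n ≤ q := by nlinarith
    exact_mod_cast h4
  obtain ⟨x, hx⟩ := exists_blockCount_eq (by omega : n ≤ q) m hm.no_larger hm.total
  obtain ⟨sp, y, z, ht, hpl, hc⟩ := exists_isTemplate (N := δ * n) hk h3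
    ((hx k hk.le).trans hm.unique_tuple)
    (fun ℓ hℓ => (hx ℓ (by omega)).trans (hm.no_larger ℓ hℓ))
    (fun r hr hrk => (hm.many r hr hrk).trans_eq (by rw [hx r hr]))
  have hA' : ∀ ω : Sym n q, ε ≤ A.outputProb (act ω (planted y z sp.1)) (sp.image ω.2) := by
    intro ω
    have h5 := hA (act ω x) fun ℓ hℓ => (blockCount_act ω x ℓ).trans (hx ℓ hℓ)
    rwa [correct_act hc, QueryAlgorithm.successProb, Finset.sum_singleton, ← hpl] at h5
  have h6 := ht.lt_queries hk (by positivity) hε h1 h2 A hA'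
  have h7 : (ε / (2 * (δ * n))) ^ p⁻¹ * (δ * n) =
      (ε / (2 * δ)) ^ p⁻¹ * δ * (n : ℝ) ^ exponent k := by
    rw [← inv_add_exponent hk, ← hp, Real.rpow_sub hn0, Real.rpow_one, ← mul_assoc 2 δ,
      ← div_div, Real.div_rpow (by positivity) hn0.le]
    ring
  rw [← hp, h7] at h6
  rw [div_mul_eq_mul_div, div_le_iff₀ (by positivity)]
  linarith

end KDistinctness

theorem theorem1 (k : ℕ) (hk : 2 ≤ k) :
    -- the lower bound for search `k`-Distinctness
    (∀ a ε : ℝ, 0 < a → 0 < ε → ∃ c : ℝ, 0 < c ∧ ∃ n₀ : ℕ, ∀ n : ℕ, n₀ ≤ n →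
      ∀ (q : ℕ) [NeZero q], a * (n : ℝ) ^ 2 ≤ q →
      ∀ A : KDistinctness.QueryAlgorithm n q (KDistinctness.Response n k),
        KDistinctness.Solves k ε A →
          c * (n : ℝ) ^ KDistinctness.exponent k ≤ A.queries) ∧
    -- it persists if there is exactly one `k`-tuple and the numbers of `ℓ`-tuples are known
    (∀ a ε δ : ℝ, 0 < a → 0 < ε → 0 < δ → ∃ c : ℝ, 0 < c ∧ ∃ n₀ : ℕ, ∀ n : ℕ, n₀ ≤ n →
      ∀ (q : ℕ) [NeZero q], a * (n : ℝ) ^ 2 ≤ q →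
      ∀ m : ℕ → ℕ, KDistinctness.IsBalancedProfile k n δ m →
      ∀ A : KDistinctness.QueryAlgorithm n q (KDistinctness.Response n k),
        KDistinctness.SolvesOnProfile k ε m A →
          c * (n : ℝ) ^ KDistinctness.exponent k ≤ A.queries) ∧
    -- and such numbers of tuples exist for all large `n`
    (∃ δ : ℝ, 0 < δ ∧ ∃ n₀ : ℕ, ∀ n : ℕ, n₀ ≤ n →
      ∃ m : ℕ → ℕ, KDistinctness.IsBalancedProfile k n δ m) := by
  have hk' : 1 < k := hk
  have h3 : ∃ δ : ℝ, 0 < δ ∧ ∃ n₀ : ℕ, ∀ n : ℕ, n₀ ≤ n →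
      ∃ m : ℕ → ℕ, KDistinctness.IsBalancedProfile k n δ m :=
    ⟨1 / (4 * k ^ 2), by positivity, 4 * k ^ 2, fun n hn =>
      KDistinctness.exists_isBalancedProfile hk' hn⟩
  refine ⟨fun a ε ha hε => ?_, fun a ε δ ha hε hδ =>
    KDistinctness.exists_le_queries_of_solvesOnProfile hk' ha hε hδ, h3⟩
  obtain ⟨δ, hδ, n₁, hn₁⟩ := h3
  obtain ⟨c, hc, n₀, h⟩ :=
    KDistinctness.exists_le_queries_of_solvesOnProfile hk' ha hε hδ
  refine ⟨c, hc, max n₀ n₁, fun n hn q _ hq A hA => ?_⟩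
  obtain ⟨m, hm⟩ := hn₁ n (le_of_max_le_right hn)
  -- Every input with a balanced profile has a `k`-block, so a general solver also solves the
  -- restricted problem.
  refine h n (le_of_max_le_left hn) q hq m hm A fun x hx => hA x ?_
  have hone : KDistinctness.blockCount x k = 1 := (hx k hk'.le).trans hm.unique_tuple
  obtain ⟨v, hv⟩ := Finset.card_pos.1 (hone ▸ Nat.one_pos : 0 < KDistinctness.blockCount x k)
  refine ⟨⟨_, (Finset.mem_filter.1 hv).2⟩, Finset.mem_filter.2
    ⟨Finset.mem_univ _, fun i hi j hj => ?_⟩⟩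
  rw [(Finset.mem_filter.1 hi).2, (Finset.mem_filter.1 hj).2]
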